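/- Let $f(s)=\sum_{n\ge 1}c_n n^{-s}$ ($c_n\in\mathbb C$) be a Dirichlet series with abscissa of pointwise convergence $\sigma_c=0$ and abscissa of absolute convergence $\sigma_a=1$. For $\sigma>0$ let $\mu(\sigma)=\inf\{m\ge 0: f(\sigma+it)\ll |t|^{m}\ (|t|\to\infty)\}$, let $\mu(0)=\lim_{\sigma\to 0^+}\mu(\sigma)$, and let $\sigma_L=\inf\{\sigma\ge 0:\mu(\sigma)=0\}$. For $k\in\mathbb N$ and $\alpha>0$ let $$\sigma_k(\alpha)=\inf\Big\{\sigma>0:\int_{-\infty}^{\infty}\frac{|f(\sigma+it)|^{2k}}{|\sigma+it|^{2\alpha+1}}\,dt<\infty\Big\}.$$ Suppose that $\mu(\sigma)=\mu(0)(1-\sigma/\sigma_L)$ for $0\le\sigma\le\sigma_L$, that $\mu(1/2)<\mu(0)/2$, and that for every fixed $0<\sigma\le 1/2$, $$|f(\sigma+it)|\asymp |t|^{\mu(0)(1-2\sigma)}\,|f(1-\sigma-it)|\qquad(|t|\to\infty),$$ with implied constants that may depend on $\sigma$. Then $\sigma_L=1/2$, and for every $\alpha>0$ and every $k\in\mathbb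 N$ with $k\ge\alpha/\mu(0)$, $$\sigma_k(\alpha)=\frac12\Big(1-\frac{\alpha}{k\mu(0)}\Big);$$ moreover $\lim_{k\to\infty}\sigma_k(\alpha)=1/2$ for every $\alpha>0$ (the case $k=\infty$). In particular the sequences $\sigma_k(\alpha)$ are concave: $\sigma_{k+1}(\alpha)-\sigma_k(\alpha)\ge\sigma_{k+2}(\alpha)-\sigma_{k+1}(\alpha)$ for all $\alpha>0$ and all $k\in\mathbb N$ with $k\ge\alpha/\mu(0)$. -/

import Mathlib

open Filter Topology MeasureTheory Asymptotics

namespace OrdinaryDirichlet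

noncomputable section

/-- Partial sums `∑_{1 ≤ n < N} c n / n ^ s` (`LSeries.term c s 0 = 0`). -/
def partialSum (c : ℕ → ℂ) (s : ℂ) (N : ℕ) : ℂ :=
  ∑ n ∈ Finset.range N, LSeries.term c s n

/-- The abscissa of pointwise (possibly conditional) convergence. -/
def abscissaOfConv (c : ℕ → ℂ) : EReal :=
  sInf (Real.toEReal '' {x : ℝ | ∃ l : ℂ, Tendsto (partialSum c (x : ℂ)) atTop (𝓝 l)})

/-- The sum `f(s)` of the (possibly only conditionally convergent) Dirichlet series. -/
def sum (c : ℕ → ℂ) (s : ℂ) : ℂ :=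
  limUnder atTop (partialSum c s)

/-- `inf {m ≥ 0 : f(σ + it) ≪ |t| ^ m as |t| → ∞}`. -/
def lineOrder (c : ℕ → ℂ) (σ : ℝ) : ℝ :=
  sInf {m : ℝ | 0 ≤ m ∧
    (fun t : ℝ => sum c (σ + t * Complex.I)) =O[atBot ⊔ atTop] (fun t : ℝ => |t| ^ m)}

/-- The order function `μ(σ)` for `σ ≥ 0`: it is `lineOrder c σ` if `σ > 0`, and `μ(0)` is the
limit of `μ(σ)` as `σ → 0` from the right. (Negative `σ` are not used.) -/
def order (c : ℕ → ℂ) (σ : ℝ) : ℝ :=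
  if 0 < σ then lineOrder c σ else limUnder (𝓝[>] (0 : ℝ)) (lineOrder c)

/-- `σ_L = inf {σ ≥ 0 : μ(σ) = 0}`. -/
def lindelofAbscissa (c : ℕ → ℂ) : ℝ :=
  sInf {σ : ℝ | 0 ≤ σ ∧ order c σ = 0}

/-- `σ_k(α)`, the infimum of the `σ` for which
`∫ |f(σ + it)| ^ (2k) / |σ + it| ^ (2α + 1) dt` over the real line is finite. As `f` lives on the
open half-plane `Re s > 0`, the infimum is over `σ > 0`. -/
def momentAbscissa (c : ℕ → ℂ) (k : ℕ) (α : ℝ) : ℝ :=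
  sInf {σ : ℝ | 0 < σ ∧
    ∫⁻ t : ℝ, ENNReal.ofReal
      (‖sum c (σ + t * Complex.I)‖ ^ (2 * k) / ‖(σ + t * Complex.I : ℂ)‖ ^ (2 * α + 1)) < ⊤}

end

end OrdinaryDirichlet

/-! Write μ for the order function and μ₀ = μ(0); the hypothesis on μ(1/2) forces μ₀ > 0. Where
μ(1-σ) = 0, reflection gives f(σ+it) ≪ |t|^(μ₀(1-2σ)+ε), so the 2k-th moment converges as soon as
kμ₀(1-2σ) < α.

The converse needs f not to be small on the reflected line. Cauchy's theorem on a rectangle compares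
the line Re s = 1-σ with one far to the right, where the first nonzero term dominates; since f(s) =
o(|s|), the horizontal sides are negligible, and the mean of |f| over [T, 2T] stays above a positive
constant (`exists_mean_lower_bound`). Reflected back, this gives μ(σ) ≥ μ₀(1-2σ), and for kμ₀(1-2σ)
≥ α it keeps the moment over dyadic blocks away from 0, so the moment diverges.

For σ_L, the bound μ(1/2) < μ₀/2 and linearity exclude σ_L ≥ 1. For small σ > 0 then 1-σ > σ_L, so
μ(σ) = μ₀(1-2σ) by reflection; comparison with the linear formula gives σ_L = 1/2. -/

namespace OrdinaryDirichlet

/-! ### Abel summation, holomorphy and growth in the half-plane of convergence. -/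

/-- Abel summation for Dirichlet series with respect to the partial sums at `x`. -/
lemma partialSum_eq_abel (c : ℕ → ℂ) (x s : ℂ) (N : ℕ) :
    partialSum c s N = partialSum c x N * (N : ℂ) ^ (-(s - x)) +
      ∑ n ∈ Finset.range N, partialSum c x (n + 1) *
        ((n : ℂ) ^ (-(s - x)) - ((n + 1 : ℕ) : ℂ) ^ (-(s - x))) := by
  induction N with
  | zero => simp [partialSum]
  | succ N ih =>
    have h1 : partialSum c s (N + 1) = partialSum c s N + LSeries.term c s N := by
      simp [partialSum, Finset.sum_range_succ]
    have h2 : partialSum c x (N + 1) = partialSum c x N + LSeries.term c x N := by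
      simp [partialSum, Finset.sum_range_succ]
    have h3 : LSeries.term c s N = LSeries.term c x N * (N : ℂ) ^ (-(s - x)) := by
      rcases eq_or_ne N 0 with rfl | hN
      · simp
      · have hN' : (N : ℂ) ≠ 0 := by exact_mod_cast hN
        rw [LSeries.term_of_ne_zero hN, LSeries.term_of_ne_zero hN, neg_sub,
          Complex.cpow_sub _ _ hN']
        have hx : (N : ℂ) ^ x ≠ 0 := by simp [Complex.cpow_eq_zero_iff, hN']
        field_simp
    rw [h1, ih, Finset.sum_range_succ, h2, h3]
    ring

/-- Mean value inequality for y ↦ y^(-w) on [n, n+1]. -/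
lemma norm_cpow_neg_sub_cpow_neg_succ_le {n : ℕ} (hn : n ≠ 0) {w : ℂ} (hw : 0 < w.re) :
    ‖(n : ℂ) ^ (-w) - ((n + 1 : ℕ) : ℂ) ^ (-w)‖ ≤ ‖w‖ * (n : ℝ) ^ (-w.re - 1) := by
  have hn0 : (0 : ℝ) < n := by positivity
  have hw0 : -w ≠ 0 := by
    intro h
    have := congrArg Complex.re h
    simp at this
    linarith
  have := Convex.norm_image_sub_le_of_norm_hasDerivWithin_le (𝕜 := ℝ)
    (f := fun y : ℝ => (y : ℂ) ^ (-w)) (f' := fun y : ℝ => -w * (y : ℂ) ^ (-w - 1))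
    (s := Set.Icc (n : ℝ) (n + 1)) (C := ‖w‖ * (n : ℝ) ^ (-w.re - 1)) (x := n) (y := n + 1)
    (fun y hy => (hasDerivAt_ofReal_cpow_const (by linarith [hy.1]) hw0).hasDerivWithinAt)
    (fun y hy => by
      have hy0 : 0 < y := by linarith [hy.1]
      rw [norm_mul, norm_neg, Complex.norm_cpow_eq_rpow_re_of_pos hy0]
      gcongr
      simp only [Complex.sub_re, Complex.neg_re, Complex.one_re]
      exact Real.rpow_le_rpow_of_nonpos hn0 hy.1 (by linarith))
    (convex_Icc _ _) ⟨le_rfl, by linarith⟩ ⟨by linarith, le_rfl⟩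
  rw [norm_sub_rev]
  simpa using this

lemma tendsto_natCast_cpow_neg {w : ℂ} (hw : 0 < w.re) :
    Tendsto (fun N : ℕ => (N : ℂ) ^ (-w)) atTop (𝓝 0) := by
  rw [tendsto_zero_iff_norm_tendsto_zero]
  have h := (tendsto_rpow_neg_atTop hw).comp (tendsto_natCast_atTop_atTop (R := ℝ))
  refine h.congr' ?_
  filter_upwards [eventually_gt_atTop 0] with N hN
  simp [Complex.norm_natCast_cpow_of_pos hN]

/-- The terms of the Abel-summed series. -/
noncomputable def abelTerm (c : ℕ → ℂ) (x s : ℂ) (n : ℕ) : ℂ :=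
  partialSum c x (n + 1) * ((n : ℂ) ^ (-(s - x)) - ((n + 1 : ℕ) : ℂ) ^ (-(s - x)))

lemma norm_abelTerm_le {c : ℕ → ℂ} {x : ℂ} {M : ℝ} (hM : ∀ N, ‖partialSum c x N‖ ≤ M)
    {δ : ℝ} (hδ : 0 < δ) {s : ℂ} (hs : δ ≤ (s - x).re) (n : ℕ) :
    ‖abelTerm c x s n‖ ≤ ‖s - x‖ * (M * (n : ℝ) ^ (-δ - 1)) := by
  have hM0 : 0 ≤ M := (norm_nonneg _).trans (hM 0)
  -- The term n = 0 vanishes because `partialSum c x 1` is 0, whatever value 0^w takes.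
  rcases eq_or_ne n 0 with rfl | hn
  · have : abelTerm c x s 0 = 0 := by simp [abelTerm, partialSum]
    rw [this, norm_zero]
    positivity
  · have hn1 : (1 : ℝ) ≤ n := by exact_mod_cast Nat.one_le_iff_ne_zero.mpr hn
    rw [abelTerm, norm_mul]
    calc _ ≤ M * (‖s - x‖ * (n : ℝ) ^ (-(s - x).re - 1)) :=
          mul_le_mul (hM _) (norm_cpow_neg_sub_cpow_neg_succ_le hn (by linarith))
            (norm_nonneg _) hM0
      _ ≤ M * (‖s - x‖ * (n : ℝ) ^ (-δ - 1)) := by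
          gcongr
      _ = _ := by ring

lemma summable_abelBound (M : ℝ) {δ : ℝ} (hδ : 0 < δ) :
    Summable (fun n : ℕ => M * (n : ℝ) ^ (-δ - 1)) :=
  (Real.summable_nat_rpow.mpr (by linarith)).mul_left M

lemma summable_abelTerm {c : ℕ → ℂ} {x : ℂ} {M : ℝ} (hM : ∀ N, ‖partialSum c x N‖ ≤ M)
    {s : ℂ} (hs : 0 < (s - x).re) : Summable (abelTerm c x s) :=
  .of_norm_bounded ((summable_abelBound M hs).mul_left _) (norm_abelTerm_le hM hs le_rfl)

lemma tendsto_partialSum {c : ℕ → ℂ} {x : ℂ} {M : ℝ} (hM : ∀ N, ‖partialSum c x N‖ ≤ M)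
    {s : ℂ} (hs : 0 < (s - x).re) :
    Tendsto (partialSum c s) atTop (𝓝 (∑' n, abelTerm c x s n)) := by
  have h1 := (summable_abelTerm hM hs).hasSum.tendsto_sum_nat
  have h2 : Tendsto (fun N => partialSum c x N * (N : ℂ) ^ (-(s - x))) atTop (𝓝 0) := by
    have hb : IsBoundedUnder (· ≤ ·) atTop (norm ∘ partialSum c x) :=
      isBoundedUnder_of ⟨M, hM⟩
    exact isBoundedUnder_le_mul_tendsto_zero hb (tendsto_natCast_cpow_neg hs)
  have h3 := h2.add h1
  rw [zero_add] at h3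
  exact h3.congr fun N => (partialSum_eq_abel c x s N).symm

lemma sum_eq_tsum_abelTerm {c : ℕ → ℂ} {x : ℂ} {M : ℝ} (hM : ∀ N, ‖partialSum c x N‖ ≤ M)
    {s : ℂ} (hs : 0 < (s - x).re) : sum c s = ∑' n, abelTerm c x s n :=
  (tendsto_partialSum hM hs).limUnder_eq

/-- The majorant of the Abel terms is uniform once |z - x| is bounded, so Weierstrass' theorem
applies on the neighbourhood `U` of s. -/
lemma differentiableAt_sum_of_bounded {c : ℕ → ℂ} {x : ℂ} {M : ℝ}
    (hM : ∀ N, ‖partialSum c x N‖ ≤ M) {s : ℂ} (hs : 0 < (s - x).re) :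
    DifferentiableAt ℂ (sum c) s := by
  set δ := (s - x).re / 2 with hδ
  set R := ‖s - x‖ + 1 with hR
  let U : Set ℂ := {z | δ < (z - x).re} ∩ {z | ‖z - x‖ < R}
  have hU : IsOpen U :=
    (isOpen_lt continuous_const (by fun_prop)).inter (isOpen_lt (by fun_prop) continuous_const)
  have hsU : s ∈ U := ⟨show δ < (s - x).re by linarith, by simp [hR]⟩
  have hM0 : 0 ≤ M := (norm_nonneg _).trans (hM 0)
  have hd : DifferentiableOn ℂ (fun z => ∑' n, abelTerm c x z n) U := by
    refine Complex.differentiableOn_tsum_of_summable_norm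
      (u := fun n : ℕ => R * (M * (n : ℝ) ^ (-δ - 1)))
      ((summable_abelBound M (by linarith)).mul_left _) (fun n => ?_) hU (fun n z hz => ?_)
    · rcases eq_or_ne n 0 with rfl | hn
      · have : (fun z => abelTerm c x z 0) = fun _ => 0 := by
          funext z
          simp [abelTerm, partialSum]
        rw [this]
        exact differentiableOn_const _
      · have hn1 : (n : ℂ) ≠ 0 := by exact_mod_cast hn
        have hn2 : ((n + 1 : ℕ) : ℂ) ≠ 0 := by exact_mod_cast n.succ_ne_zero
        intro z _
        apply DifferentiableAt.differentiableWithinAt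
        unfold abelTerm
        apply DifferentiableAt.const_mul
        apply DifferentiableAt.sub
        · exact DifferentiableAt.const_cpow (by fun_prop) (Or.inl hn1)
        · exact DifferentiableAt.const_cpow (by fun_prop) (Or.inl hn2)
    · refine (norm_abelTerm_le hM (δ := δ) (by linarith) hz.1.le n).trans ?_
      gcongr
      exact hz.2.le
  refine (hd.differentiableAt (hU.mem_nhds hsU)).congr_of_eventuallyEq ?_
  filter_upwards [hU.mem_nhds hsU] with z hz
  exact sum_eq_tsum_abelTerm hM (by linarith [hz.1.out])

/-- In a half-plane strictly inside the half-plane of convergence, `f(s) = o(|s|)` uniformly. -/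
lemma norm_sum_le_of_bounded {c : ℕ → ℂ} {x : ℂ} {M : ℝ}
    (hM : ∀ N, ‖partialSum c x N‖ ≤ M) {δ : ℝ} (hδ : 0 < δ) {ε : ℝ} (hε : 0 < ε) :
    ∃ C, ∀ s : ℂ, δ ≤ (s - x).re → ‖sum c s‖ ≤ C + ε * ‖s - x‖ := by
  have hM0 : 0 ≤ M := (norm_nonneg _).trans (hM 0)
  have hsum := summable_abelBound M hδ
  -- Only the tail from K on contributes a multiple of |s - x|, and K makes that multiple less than
  -- ε; the first K terms are bounded.
  obtain ⟨K, hK⟩ := ((tendsto_sum_nat_add fun n : ℕ => M * (n : ℝ) ^ (-δ - 1)).eventually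
    (gt_mem_nhds hε)).exists
  refine ⟨K * (2 * M), fun s hs => ?_⟩
  have hs0 : 0 < (s - x).re := by linarith
  rw [sum_eq_tsum_abelTerm hM hs0, ← (summable_abelTerm hM hs0).sum_add_tsum_nat_add K]
  refine (norm_add_le _ _).trans (add_le_add ?_ ?_)
  · refine (norm_sum_le _ _).trans ?_
    have : ∀ n ∈ Finset.range K, ‖abelTerm c x s n‖ ≤ 2 * M := by
      intro n _
      rcases eq_or_ne n 0 with rfl | hn
      · simp [abelTerm, partialSum, hM0]
      have hb : ∀ m : ℕ, m ≠ 0 → ‖(m : ℂ) ^ (-(s - x))‖ ≤ 1 := by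
        intro m hm
        rw [Complex.norm_natCast_cpow_of_pos (Nat.pos_of_ne_zero hm)]
        apply Real.rpow_le_one_of_one_le_of_nonpos
        · exact_mod_cast Nat.one_le_iff_ne_zero.mpr hm
        · rw [Complex.neg_re]; linarith
      rw [abelTerm, norm_mul]
      calc _ ≤ M * (1 + 1) := by
            apply mul_le_mul (hM _) _ (norm_nonneg _) hM0
            exact (norm_sub_le _ _).trans (add_le_add (hb _ hn) (hb _ n.succ_ne_zero))
        _ = 2 * M := by ring
    refine (Finset.sum_le_sum this).trans ?_
    simp
  · have hs' := ((summable_nat_add_iff K).mpr hsum).mul_left ‖s - x‖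
    refine (tsum_of_norm_bounded hs'.hasSum fun n => norm_abelTerm_le hM hδ hs _).trans ?_
    rw [tsum_mul_left, mul_comm]
    gcongr

lemma exists_bounded_partialSum {c : ℕ → ℂ} (hconv : abscissaOfConv c = 0) {δ : ℝ} (hδ : 0 < δ) :
    ∃ x : ℝ, x < δ ∧ ∃ M, ∀ N, ‖partialSum c (x : ℂ) N‖ ≤ M := by
  have h : abscissaOfConv c < (δ : EReal) := by rw [hconv]; exact_mod_cast hδ
  obtain ⟨_, ⟨x, ⟨l, hl⟩, rfl⟩, hx⟩ := sInf_lt_iff.mp h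
  refine ⟨x, by exact_mod_cast hx, ?_⟩
  obtain ⟨M, hM⟩ := (Metric.isBounded_range_of_tendsto _ hl).exists_norm_le
  exact ⟨M, fun N => hM _ ⟨N, rfl⟩⟩

lemma differentiableAt_sum {c : ℕ → ℂ} (hconv : abscissaOfConv c = 0) {s : ℂ} (hs : 0 < s.re) :
    DifferentiableAt ℂ (sum c) s := by
  obtain ⟨x, hx, M, hM⟩ := exists_bounded_partialSum hconv hs
  exact differentiableAt_sum_of_bounded hM (by simpa using hx)

lemma norm_sum_le {c : ℕ → ℂ} (hconv : abscissaOfConv c = 0) {δ : ℝ} (hδ : 0 < δ)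
    {ε : ℝ} (hε : 0 < ε) :
    ∃ C, 0 ≤ C ∧ ∀ s : ℂ, δ ≤ s.re → ‖sum c s‖ ≤ C + ε * ‖s‖ := by
  obtain ⟨x, hx, M, hM⟩ := exists_bounded_partialSum hconv hδ
  obtain ⟨C, hC⟩ := norm_sum_le_of_bounded hM (sub_pos.mpr hx) hε
  refine ⟨|C| + ε * ‖(x : ℂ)‖, by positivity, fun s hs => ?_⟩
  refine (hC s (by simpa using hs)).trans ?_
  have := mul_le_mul_of_nonneg_left (norm_sub_le s (x : ℂ)) hε.le
  linarith [le_abs_self C]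

lemma continuous_sum_line {c : ℕ → ℂ} (hconv : abscissaOfConv c = 0) {σ : ℝ} (hσ : 0 < σ) :
    Continuous fun t : ℝ => sum c (σ + t * Complex.I) := by
  rw [continuous_iff_continuousAt]
  intro t
  have h : ContinuousAt (sum c) ((σ : ℂ) + t * Complex.I) :=
    (differentiableAt_sum hconv (by simpa using hσ)).continuousAt
  exact ContinuousAt.comp (f := fun t : ℝ => (σ : ℂ) + t * Complex.I) h
    (by fun_prop)

lemma sum_eq_LSeries {c : ℕ → ℂ} {s : ℂ} (h : LSeriesSummable c s) : sum c s = LSeries c s :=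
  (HasSum.tendsto_sum_nat (Summable.hasSum h)).limUnder_eq

lemma exists_norm_sum_le_of_two_le_re {c : ℕ → ℂ} (habs : LSeries.abscissaOfAbsConv c = 1) :
    ∃ B, 0 ≤ B ∧ ∀ s : ℂ, 2 ≤ s.re → ‖sum c s‖ ≤ B := by
  have hsum : ∀ s : ℂ, 2 ≤ s.re → LSeriesSummable c s := fun s hs =>
    LSeriesSummable_of_abscissaOfAbsConv_lt_re (by
      rw [habs]; exact_mod_cast (by linarith : (1 : ℝ) < s.re))
  have h2 := (hsum 2 (by simp)).norm
  refine ⟨∑' n, ‖LSeries.term c 2 n‖, tsum_nonneg fun _ => norm_nonneg _, fun s hs => ?_⟩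
  rw [sum_eq_LSeries (hsum s hs)]
  exact tsum_of_norm_bounded h2.hasSum fun n =>
    LSeries.norm_term_le_of_re_le_re c (by simpa using hs) n

/-! ### Order on vertical lines and Phragmén–Lindelöf. -/

lemma eventually_le_abs (R : ℝ) : ∀ᶠ t : ℝ in atBot ⊔ atTop, R ≤ |t| := by
  rw [← IsOrderBornology.cobounded_eq]
  exact tendsto_norm_cobounded_atTop.eventually_ge_atTop R

lemma eventually_abs_iff {p : ℝ → Prop} :
    (∀ᶠ t : ℝ in atBot ⊔ atTop, p t) ↔ ∃ R : ℝ, 0 < R ∧ ∀ t : ℝ, R ≤ |t| → p t := by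
  constructor
  · intro h
    rw [eventually_sup, eventually_atBot, eventually_atTop] at h
    obtain ⟨⟨a, ha⟩, b, hb⟩ := h
    refine ⟨max 1 (max (-a) b), by positivity, fun t ht => ?_⟩
    simp only [max_le_iff] at ht
    rcases le_abs'.mp ht.1 with h0 | h0
    · apply ha
      rw [abs_of_neg (by linarith)] at ht
      linarith
    · apply hb
      rw [abs_of_pos (by linarith)] at ht
      linarith
  · rintro ⟨R, -, hR⟩
    filter_upwards [eventually_le_abs R] with t ht using hR t ht

lemma isBigO_abs_rpow {m m' : ℝ} (h : m ≤ m') :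
    (fun t : ℝ => |t| ^ m) =O[atBot ⊔ atTop] (fun t : ℝ => |t| ^ m') := by
  refine IsBigO.of_bound 1 ?_
  filter_upwards [eventually_le_abs 1] with t ht
  rw [one_mul, Real.norm_of_nonneg (by positivity), Real.norm_of_nonneg (by positivity)]
  exact Real.rpow_le_rpow_of_exponent_le ht h

lemma lineOrder_nonneg (c : ℕ → ℂ) (σ : ℝ) : 0 ≤ lineOrder c σ :=
  Real.sInf_nonneg fun _ hm => hm.1

lemma lineOrder_le_of_isBigO {c : ℕ → ℂ} {σ m : ℝ} (hm : 0 ≤ m)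
    (h : (fun t : ℝ => sum c (σ + t * Complex.I)) =O[atBot ⊔ atTop] (fun t : ℝ => |t| ^ m)) :
    lineOrder c σ ≤ m :=
  csInf_le ⟨0, fun _ hm => hm.1⟩ ⟨hm, h⟩

/-- Makes the set defining `lineOrder` nonempty, so that its infimum is not the default value 0. -/
lemma isBigO_sum_line {c : ℕ → ℂ} (hconv : abscissaOfConv c = 0) {σ : ℝ} (hσ : 0 < σ) :
    (fun t : ℝ => sum c (σ + t * Complex.I)) =O[atBot ⊔ atTop] (fun t : ℝ => |t| ^ (1 : ℝ)) := by
  obtain ⟨C, hC0, hC⟩ := norm_sum_le hconv hσ one_pos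
  refine IsBigO.of_bound (C + σ + 1) ?_
  filter_upwards [eventually_le_abs 1] with t ht
  refine (hC _ (by simp)).trans ?_
  have : ‖(σ : ℂ) + t * Complex.I‖ ≤ σ + |t| := by
    refine (norm_add_le _ _).trans ?_
    simp [abs_of_pos hσ]
  rw [Real.rpow_one, Real.norm_of_nonneg (abs_nonneg t)]
  nlinarith

lemma isBigO_of_lineOrder_lt {c : ℕ → ℂ} (hconv : abscissaOfConv c = 0) {σ : ℝ} (hσ : 0 < σ)
    {m : ℝ} (h : lineOrder c σ < m) :
    (fun t : ℝ => sum c (σ + t * Complex.I)) =O[atBot ⊔ atTop] (fun t : ℝ => |t| ^ m) := by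
  obtain ⟨m', hm', hlt⟩ := exists_lt_of_csInf_lt
    (by exact ⟨1, zero_le_one, isBigO_sum_line hconv hσ⟩) h
  exact hm'.2.trans (isBigO_abs_rpow hlt.le)

/-- Phragmén–Lindelöf: a power bound on a vertical line holds in the half-plane to its right. -/
lemma exists_norm_sum_le_rpow {c : ℕ → ℂ} (hconv : abscissaOfConv c = 0)
    (habs : LSeries.abscissaOfAbsConv c = 1) {σ : ℝ} (hσ : 0 < σ) {m : ℝ} (hm : 0 ≤ m)
    (h : (fun t : ℝ => sum c (σ + t * Complex.I)) =O[atBot ⊔ atTop] (fun t : ℝ => |t| ^ m)) :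
    ∃ C, ∀ z : ℂ, 0 ≤ z.re → ‖sum c (σ + z)‖ ≤ C * ‖1 + z‖ ^ m := by
  have hone : ∀ z : ℂ, 0 ≤ z.re → 1 ≤ ‖1 + z‖ := fun z hz => by
    have := Complex.re_le_norm (1 + z)
    simp only [Complex.add_re, Complex.one_re] at this
    linarith
  have hone' : ∀ z : ℂ, 0 ≤ z.re → 1 ≤ ‖1 + z‖ ^ m := fun z hz =>
    Real.one_le_rpow (hone z hz) hm
  obtain ⟨C, hC⟩ : ∃ C, ∀ t : ℝ, ‖sum c (σ + t * Complex.I)‖ ≤ C * ‖1 + t * Complex.I‖ ^ m := by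
    obtain ⟨K, hK0, hK⟩ := h.exists_nonneg
    obtain ⟨R, hR0, hR⟩ := eventually_abs_iff.mp hK.bound
    obtain ⟨K', hK'⟩ := (isCompact_Icc (a := -R) (b := R)).exists_bound_of_continuousOn
      (continuous_sum_line hconv hσ).continuousOn
    have hK'0 : 0 ≤ K' := (norm_nonneg _).trans (hK' 0 ⟨by linarith, hR0.le⟩)
    refine ⟨K + K', fun t => ?_⟩
    have h1 := hone' (t * Complex.I) (by simp)
    rw [add_mul]
    rcases le_total R |t| with ht | ht
    · have h2 : |t| ≤ ‖1 + t * Complex.I‖ := by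
        have := Complex.abs_im_le_norm (1 + t * Complex.I)
        simpa using this
      have h3 : |t| ^ m ≤ ‖1 + t * Complex.I‖ ^ m := by gcongr
      have h4 := hR t ht
      rw [Real.norm_of_nonneg (by positivity)] at h4
      nlinarith
    · have := hK' t (abs_le.mp ht)
      nlinarith
  obtain ⟨B, hB0, hB⟩ := exists_norm_sum_le_of_two_le_re habs
  obtain ⟨D, hD0, hD⟩ := norm_sum_le hconv hσ one_pos
  -- Division by (1+z)^m, of modulus at least 1 for Re z ≥ 0, turns the power bound on the imaginary
  -- axis into a constant one. The growth of g is at most linear, and g is bounded on the positive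
  -- reals by absolute convergence.
  let g : ℂ → ℂ := fun z => sum c (σ + z) / (1 + z) ^ (m : ℂ)
  have hg : ∀ z, ‖g z‖ = ‖sum c (σ + z)‖ / ‖1 + z‖ ^ m := fun z => by
    simp only [g, norm_div, Complex.norm_cpow_real]
  have hgle : ∀ z : ℂ, 0 ≤ z.re → ‖g z‖ ≤ ‖sum c (σ + z)‖ := fun z hz => by
    rw [hg]
    exact div_le_self (norm_nonneg _) (hone' z hz)
  refine ⟨C, fun z hz => ?_⟩
  rw [← div_le_iff₀ (by linarith [hone' z hz]), ← hg]
  refine PhragmenLindelof.right_half_plane_of_bounded_on_real ?_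
    ⟨1, by norm_num, 1, ?_⟩ ?_ (fun t => ?_) hz
  · apply DifferentiableOn.diffContOnCl
    rw [Complex.closure_setOfPred_lt_re]
    intro z hz
    have hz' : 0 ≤ z.re := hz
    apply DifferentiableAt.differentiableWithinAt
    have h1 : DifferentiableAt ℂ (fun z => sum c (σ + z)) z :=
      DifferentiableAt.comp (f := fun z : ℂ => (σ : ℂ) + z) z
        (differentiableAt_sum hconv (by simp; linarith)) (by fun_prop)
    have hslit : 1 + z ∈ Complex.slitPlane := Or.inl (by simp; linarith)
    refine h1.div (DifferentiableAt.cpow (by fun_prop) (by fun_prop) hslit) ?_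
    rw [← norm_ne_zero_iff, Complex.norm_cpow_real]
    linarith [hone' z hz']
  · refine IsBigO.of_bound (D + σ + 1) ?_
    filter_upwards [eventually_inf_principal.mpr (Eventually.of_forall fun z hz => hz)] with z hz
    have hz' : 0 < z.re := hz
    refine (hgle z hz'.le).trans ((hD _ (by simp; linarith)).trans ?_)
    have h1 : ‖(σ : ℂ) + z‖ ≤ σ + ‖z‖ := by
      refine (norm_add_le _ _).trans ?_
      simp [abs_of_pos hσ]
    rw [one_mul, one_mul, Real.rpow_one, Real.norm_of_nonneg (Real.exp_pos _).le]
    have h2 := Real.add_one_le_exp ‖z‖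
    have h3 := norm_nonneg z
    nlinarith
  · refine isBoundedUnder_of_eventually_le (a := B) ?_
    filter_upwards [eventually_ge_atTop 2] with x hx
    refine (hgle x (by simp; linarith)).trans (hB _ ?_)
    simp
    linarith
  · rw [hg, div_le_iff₀ (by linarith [hone' (t * Complex.I) (by simp)])]
    exact hC t

lemma lineOrder_antitone {c : ℕ → ℂ} (hconv : abscissaOfConv c = 0)
    (habs : LSeries.abscissaOfAbsConv c = 1) {σ τ : ℝ} (hσ : 0 < σ) (h : σ ≤ τ) :
    lineOrder c τ ≤ lineOrder c σ := by
  apply le_of_forall_gt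
  intro m hm
  obtain ⟨m', h1, h2⟩ := exists_between hm
  have hm0 : 0 ≤ m' := (lineOrder_nonneg c σ).trans h1.le
  refine (lineOrder_le_of_isBigO hm0 ?_).trans_lt h2
  obtain ⟨C, hC⟩ := exists_norm_sum_le_rpow hconv habs hσ hm0 (isBigO_of_lineOrder_lt hconv hσ h1)
  have hC0 : 0 ≤ C := by
    simpa using (norm_nonneg _).trans (hC 0 (by simp))
  refine IsBigO.of_bound (C * (2 + (τ - σ)) ^ m') ?_
  filter_upwards [eventually_le_abs 1] with t ht
  have h3 := hC ((τ - σ : ℝ) + t * Complex.I) (by simp; linarith)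
  have h4 : (σ : ℂ) + ((τ - σ : ℝ) + t * Complex.I) = τ + t * Complex.I := by push_cast; ring
  rw [h4] at h3
  refine h3.trans ?_
  rw [Real.norm_of_nonneg (by positivity), mul_assoc, ← Real.mul_rpow (by linarith) (abs_nonneg t)]
  gcongr
  have h5 : ‖(1 : ℂ) + ((τ - σ : ℝ) + t * Complex.I)‖ ≤ 1 + ((τ - σ) + |t|) := by
    refine (norm_add_le _ _).trans ?_
    rw [norm_one]
    gcongr
    refine (norm_add_le _ _).trans ?_
    rw [Complex.norm_real, Real.norm_of_nonneg (by linarith)]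
    simp
  nlinarith

lemma lineOrder_two {c : ℕ → ℂ} (habs : LSeries.abscissaOfAbsConv c = 1) : lineOrder c 2 = 0 := by
  refine le_antisymm (lineOrder_le_of_isBigO le_rfl ?_) (lineOrder_nonneg _ _)
  obtain ⟨B, -, hB⟩ := exists_norm_sum_le_of_two_le_re habs
  refine IsBigO.of_bound B (Eventually.of_forall fun t => ?_)
  simpa using hB ((2 : ℝ) + t * Complex.I) (by simp)

/-! ### Lower bound in mean on vertical lines. -/

lemma exists_coeff_ne_zero {c : ℕ → ℂ} (habs : LSeries.abscissaOfAbsConv c = 1) :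
    ∃ n, n ≠ 0 ∧ c n ≠ 0 := by
  by_contra! h
  have h0 : ∀ s : ℂ, LSeriesSummable c s := fun s =>
    (LSeriesSummable_congr s (g := 0) fun {n} hn => h n hn).mpr LSeriesSummable_zero
  have h1 := (h0 0).abscissaOfAbsConv_le
  rw [habs] at h1
  exact absurd h1 (by simp)

/-- Far to the right, a Dirichlet series is dominated by its first nonzero term. -/
lemma exists_first_term_dominates {c : ℕ → ℂ} (habs : LSeries.abscissaOfAbsConv c = 1) (b₀ : ℝ) :
    ∃ N : ℕ, N ≠ 0 ∧ c N ≠ 0 ∧ ∃ b, b₀ ≤ b ∧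
      ∀ s : ℂ, s.re = b → ‖(N : ℂ) ^ s * sum c s - c N‖ ≤ ‖c N‖ / 2 := by
  classical
  obtain ⟨N, ⟨hN, hcN⟩, hmin⟩ : ∃ N, (N ≠ 0 ∧ c N ≠ 0) ∧ ∀ n < N, ¬ (n ≠ 0 ∧ c n ≠ 0) :=
    ⟨_, Nat.find_spec (exists_coeff_ne_zero habs), fun n hn => Nat.find_min _ hn⟩
  have hsum : ∀ s : ℂ, 2 ≤ s.re → LSeriesSummable c s := fun s hs =>
    LSeriesSummable_of_abscissaOfAbsConv_lt_re (by
      rw [habs]; exact_mod_cast (by linarith : (1 : ℝ) < s.re))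
  have h2 := (hsum 2 (by simp)).norm
  set B := ∑' n, ‖LSeries.term c 2 n‖ with hB
  have hN0 : (0 : ℝ) < N := by positivity
  -- N/n ≤ r for every n > N, so moving the line from 2 to 2 + y gains a factor r^y on the
  -- absolutely convergent tail.
  set r : ℝ := N / (N + 1) with hr
  have hr0 : 0 < r := by positivity
  have hr1 : r < 1 := by rw [hr, div_lt_one (by positivity)]; linarith
  have hlim : Tendsto (fun y : ℝ => (N : ℝ) ^ (2 : ℝ) * r ^ y * B) atTop (𝓝 0) := by
    have := ((tendsto_rpow_atTop_of_base_lt_one r (by linarith) hr1).const_mul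
      ((N : ℝ) ^ (2 : ℝ))).mul_const B
    simpa using this
  have hpos : 0 < ‖c N‖ / 2 := by positivity
  obtain ⟨y, hy, hyb, hy0⟩ := ((hlim.eventually (gt_mem_nhds hpos)).and
    ((eventually_ge_atTop b₀).and (eventually_ge_atTop 0))).exists
  refine ⟨N, hN, hcN, 2 + y, by linarith, fun s hs => ?_⟩
  have hNc : (N : ℂ) ≠ 0 := by exact_mod_cast hN
  have hS : Summable fun n => (N : ℂ) ^ s * LSeries.term c s n :=
    Summable.mul_left _ (hsum s (by linarith))
  have hterm : (N : ℂ) ^ s * LSeries.term c s N = c N := by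
    have hx : (N : ℂ) ^ s ≠ 0 := by simp [Complex.cpow_eq_zero_iff, hNc]
    rw [LSeries.term_of_ne_zero hN]
    field_simp
  rw [sum_eq_LSeries (hsum s (by linarith)), LSeries, ← tsum_mul_left, hS.tsum_eq_add_tsum_ite N,
    hterm, add_sub_cancel_left]
  refine le_trans ?_ hy.le
  refine tsum_of_norm_bounded (h2.hasSum.mul_left ((N : ℝ) ^ (2 : ℝ) * r ^ y)) fun n => ?_
  split_ifs with hn
  · rw [norm_zero]
    positivity
  rcases eq_or_ne n 0 with rfl | hn0
  · simp
  rcases lt_or_gt_of_ne hn with hlt | hgt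
  · have hcn : c n = 0 := by
      by_contra h
      exact hmin n hlt ⟨hn0, h⟩
    simp [LSeries.term_of_ne_zero hn0, hcn]
  · have hnp : (0 : ℝ) < n := by positivity
    have hle : (N : ℝ) / n ≤ r := by
      rw [hr]
      gcongr
      exact_mod_cast hgt
    have hpow : ((N : ℝ) / n) ^ y ≤ r ^ y := by gcongr
    rw [norm_mul, LSeries.norm_term_eq, LSeries.norm_term_eq, if_neg hn0, if_neg hn0,
      Complex.norm_natCast_cpow_of_pos (Nat.pos_of_ne_zero hN), hs, Real.rpow_add hN0,
      Real.rpow_add hnp]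
    simp only [Complex.re_ofNat]
    have hny : (0 : ℝ) < (n : ℝ) ^ y := by positivity
    have hn2 : (0 : ℝ) < (n : ℝ) ^ (2 : ℝ) := by positivity
    calc _ = (N : ℝ) ^ (2 : ℝ) * ((N : ℝ) / n) ^ y * (‖c n‖ / (n : ℝ) ^ (2 : ℝ)) := by
          rw [Real.div_rpow hN0.le hnp.le]
          field_simp
      _ ≤ _ := by gcongr

/-- The mean of `|f|` over `[T, 2T]` on a vertical line in the half-plane of convergence stays away
from zero. -/
lemma exists_mean_lower_bound {c : ℕ → ℂ} (hconv : abscissaOfConv c = 0)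
    (habs : LSeries.abscissaOfAbsConv c = 1) {σ : ℝ} (hσ : 0 < σ) :
    ∃ A, 0 < A ∧ ∃ T₀, 0 < T₀ ∧ ∀ T, T₀ ≤ T →
      A * T ≤ ∫ t in T..2 * T, ‖sum c (σ + t * Complex.I)‖ := by
  obtain ⟨N, hN, hcN, b, hσb, hb⟩ := exists_first_term_dominates habs σ
  have hb0 : 0 < b := by linarith
  have hNc : (N : ℂ) ≠ 0 := by exact_mod_cast hN
  have hNpos := Nat.pos_of_ne_zero hN
  have hN0 : (0 : ℝ) < N := by positivity
  have hN1 : (1 : ℝ) ≤ N := by exact_mod_cast hNpos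
  set a := ‖c N‖ with ha
  have ha0 : 0 < a := by positivity
  set D := (N : ℝ) ^ b * (b - σ) with hD
  have hD0 : 0 ≤ D := mul_nonneg (by positivity) (by linarith)
  -- The right side of the rectangle contributes at least aT/2. This ε and the choice of T₀ keep the
  -- two horizontal sides below 3aT/8 together, leaving aT/8 for the left side.
  set ε := a / (16 * (D + 1)) with hε
  have hε0 : 0 < ε := by positivity
  have hεD : D * ε ≤ a / 16 := by
    rw [hε, mul_div_assoc', div_le_div_iff₀ (by positivity) (by norm_num)]
    nlinarith
  obtain ⟨C, hC0, hC⟩ := norm_sum_le hconv hσ hε0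
  let g : ℂ → ℂ := fun z => (N : ℂ) ^ z * sum c z
  have hgd : ∀ z : ℂ, 0 < z.re → DifferentiableAt ℂ g z := fun z hz =>
    (DifferentiableAt.const_cpow (by fun_prop) (Or.inl hNc)).mul (differentiableAt_sum hconv hz)
  have hgline : ∀ x : ℝ, 0 < x → Continuous fun y : ℝ => g (x + y * Complex.I) := fun x hx => by
    refine Continuous.mul ?_ (continuous_sum_line hconv hx)
    exact Continuous.const_cpow (by fun_prop) (Or.inl hNc)
  have hgn : ∀ z : ℂ, ‖g z‖ = (N : ℝ) ^ z.re * ‖sum c z‖ := fun z => by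
    simp only [g, norm_mul, Complex.norm_natCast_cpow_of_pos hNpos]
  have hhor : ∀ y : ℝ, ‖∫ x in σ..b, g (x + y * Complex.I)‖ ≤ D * (C + ε * (b + |y|)) := by
    intro y
    have := intervalIntegral.norm_integral_le_of_norm_le_const (a := σ) (b := b)
      (f := fun x : ℝ => g (x + y * Complex.I)) (C := (N : ℝ) ^ b * (C + ε * (b + |y|)))
      (fun x hx => by
        rw [Set.uIoc_of_le hσb] at hx
        have hx0 : 0 < x := hσ.trans hx.1
        have hn : ‖(x : ℂ) + y * Complex.I‖ ≤ b + |y| := by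
          refine (norm_add_le _ _).trans ?_
          rw [Complex.norm_real, Real.norm_of_nonneg hx0.le]
          simpa using hx.2
        rw [hgn]
        gcongr
        · simpa using hx.2
        · exact (hC _ (by simpa using hx.1.le)).trans (by gcongr))
    refine this.trans_eq ?_
    rw [abs_of_nonneg (by linarith : 0 ≤ b - σ), hD]
    ring
  refine ⟨a / (8 * (N : ℝ) ^ σ), by positivity, 1 + 16 * (D * (C + ε * b)) / a, by positivity,
    fun T hT => ?_⟩
  have hT0 : 0 < T := lt_of_lt_of_le (by positivity) hT
  have hT' : 16 * (D * (C + ε * b)) ≤ a * T := by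
    have : 16 * (D * (C + ε * b)) / a ≤ T := by linarith
    rwa [div_le_iff₀ ha0, mul_comm T] at this
  have hrect := Complex.integral_boundary_rect_eq_zero_of_differentiableOn g
    (σ + T * Complex.I) (b + (2 * T : ℝ) * Complex.I) (fun z hz => by
      apply (hgd z _).differentiableWithinAt
      have := hz.1
      simp only [Complex.add_re, Complex.ofReal_re, Complex.mul_re, Complex.I_re,
        mul_zero, Complex.ofReal_im, Complex.I_im, mul_one, sub_zero, add_zero,
        Set.mem_preimage, Set.uIcc_of_le hσb] at this
      exact hσ.trans_le this.1)
  simp only [Complex.add_re, Complex.ofReal_re, Complex.mul_re, Complex.I_re,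
        mul_zero, Complex.ofReal_im, Complex.I_im, mul_one, sub_zero, add_zero,
        Complex.add_im, Complex.mul_im, zero_add] at hrect
  have hright : a * T / 2 ≤ ‖∫ y in T..2 * T, g (b + y * Complex.I)‖ := by
    have h1 := intervalIntegral.norm_integral_le_of_norm_le_const (a := T) (b := 2 * T)
      (f := fun y : ℝ => g (b + y * Complex.I) - c N) (C := a / 2)
      (fun y _ => hb _ (by simp))
    rw [intervalIntegral.integral_sub ((hgline b hb0).intervalIntegrable _ _) (by simp),
      intervalIntegral.integral_const, abs_of_nonneg (by linarith)] at h1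
    have h2 : ‖(2 * T - T) • c N‖ = T * a := by
      rw [norm_smul, Real.norm_of_nonneg (by linarith)]
      ring
    have h3 := norm_sub_norm_le ((2 * T - T) • c N) (∫ y in T..2 * T, g (b + y * Complex.I))
    rw [h2, norm_sub_rev] at h3
    linarith
  have hleft : ‖∫ y in T..2 * T, g (σ + y * Complex.I)‖ ≤
      (N : ℝ) ^ σ * ∫ t in T..2 * T, ‖sum c (σ + t * Complex.I)‖ := by
    refine (intervalIntegral.norm_integral_le_integral_norm (by linarith)).trans_eq ?_
    rw [← intervalIntegral.integral_const_mul]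
    congr 1
    funext y
    rw [hgn]
    simp
  have h1 := hhor T
  have h2 := hhor (2 * T)
  rw [abs_of_pos hT0] at h1
  rw [abs_of_pos (by linarith : 0 < 2 * T)] at h2
  have h3 : ‖∫ y in T..2 * T, g (b + y * Complex.I)‖ ≤
      ‖∫ y in T..2 * T, g (σ + y * Complex.I)‖ + ‖∫ x in σ..b, g (x + T * Complex.I)‖ +
        ‖∫ x in σ..b, g (x + (2 * T : ℝ) * Complex.I)‖ := by
    have h4 : Complex.I • (∫ y in T..2 * T, g (b + y * Complex.I)) =
        Complex.I • (∫ y in T..2 * T, g (σ + y * Complex.I)) -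
        (∫ x in σ..b, g (x + T * Complex.I)) +
          ∫ x in σ..b, g (x + (2 * T : ℝ) * Complex.I) := by
      linear_combination hrect
    have h5 := congrArg norm h4
    rw [norm_smul, Complex.norm_I, one_mul] at h5
    rw [h5]
    refine (norm_add_le _ _).trans (add_le_add_left ((norm_sub_le _ _).trans ?_) _)
    rw [norm_smul, Complex.norm_I, one_mul]
  have h6 : D * (C + ε * (b + T)) + D * (C + ε * (b + 2 * T)) ≤ 3 * a * T / 8 := by
    nlinarith [mul_le_mul_of_nonneg_right hεD hT0.le]
  rw [div_mul_eq_mul_div, div_le_iff₀ (by positivity)]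
  nlinarith

/-! ### Consequences of the reflection hypothesis for the order. -/

lemma reflect_eq (σ t : ℝ) :
    (1 - σ - t * Complex.I : ℂ) = ((1 - σ : ℝ) : ℂ) + ((-t : ℝ) : ℂ) * Complex.I := by
  push_cast
  ring

lemma isBigO_of_symm {c : ℕ → ℂ} (hconv : abscissaOfConv c = 0) {σ e : ℝ} (hσ1 : σ < 1)
    (hsymm : (fun t : ℝ => sum c (σ + t * Complex.I)) =Θ[atBot ⊔ atTop]
      (fun t : ℝ => |t| ^ e * ‖sum c (1 - σ - t * Complex.I)‖))
    (h0 : lineOrder c (1 - σ) = 0) {ε : ℝ} (hε : 0 < ε) :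
    (fun t : ℝ => sum c (σ + t * Complex.I)) =O[atBot ⊔ atTop] (fun t : ℝ => |t| ^ (e + ε)) := by
  have h1 := isBigO_of_lineOrder_lt hconv (σ := 1 - σ) (by linarith) (h0.trans_lt hε)
  have hneg : Tendsto (fun t : ℝ => -t) (atBot ⊔ atTop) (atBot ⊔ atTop) := by
    rw [← IsOrderBornology.cobounded_eq]
    exact tendsto_neg_cobounded
  have h2 := (h1.comp_tendsto hneg).norm_left
  have h3 := hsymm.1.trans ((isBigO_refl (fun t : ℝ => |t| ^ e) _).mul
    (h2.congr_left (f₂ := fun t : ℝ => ‖sum c (1 - σ - t * Complex.I)‖) fun t => by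
      simp only [Function.comp_def, reflect_eq]))
  refine h3.congr' EventuallyEq.rfl ?_
  filter_upwards [eventually_le_abs 1] with t ht
  simp only [Function.comp_def, abs_neg]
  rw [Real.rpow_add (by linarith)]

/-- The lower bound contained in the reflection hypothesis, along `t → -∞`. -/
lemma exists_lower_of_symm {c : ℕ → ℂ} {σ e : ℝ}
    (hsymm : (fun t : ℝ => sum c (σ + t * Complex.I)) =Θ[atBot ⊔ atTop]
      (fun t : ℝ => |t| ^ e * ‖sum c (1 - σ - t * Complex.I)‖)) :
    ∃ K, 0 < K ∧ ∃ R, 0 < R ∧ ∀ u : ℝ, R ≤ u →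
      u ^ e * ‖sum c ((1 - σ : ℝ) + u * Complex.I)‖ ≤
        K * ‖sum c (σ + (-u : ℝ) * Complex.I)‖ := by
  obtain ⟨K, hK0, hK⟩ := hsymm.2.exists_pos
  obtain ⟨R, hR0, hR⟩ := eventually_abs_iff.mp hK.bound
  refine ⟨K, hK0, R, hR0, fun u hu => ?_⟩
  have hu0 : 0 < u := hR0.trans_le hu
  -- Taking t = -u puts the reflected point at ordinate +u, where the lower bound in mean is
  -- available.
  have h := hR (-u) (by rwa [abs_neg, abs_of_pos hu0])
  rw [Real.norm_of_nonneg (by positivity), reflect_eq, neg_neg, abs_neg, abs_of_pos hu0] at h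
  exact h

/-- If the order were below e, reflection would force f(1-σ+iu) → 0 as u → ∞, against the lower
bound in mean. -/
lemma lineOrder_eq_of_symm {c : ℕ → ℂ} (hconv : abscissaOfConv c = 0)
    (habs : LSeries.abscissaOfAbsConv c = 1) {σ e : ℝ} (hσ : 0 < σ) (hσ1 : σ < 1) (he : 0 ≤ e)
    (hsymm : (fun t : ℝ => sum c (σ + t * Complex.I)) =Θ[atBot ⊔ atTop]
      (fun t : ℝ => |t| ^ e * ‖sum c (1 - σ - t * Complex.I)‖))
    (h0 : lineOrder c (1 - σ) = 0) : lineOrder c σ = e := by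
  refine le_antisymm (le_of_forall_pos_le_add fun ε hε =>
    lineOrder_le_of_isBigO (by positivity) (isBigO_of_symm hconv hσ1 hsymm h0 hε)) ?_
  by_contra! hlt
  obtain ⟨m, hm1, hm2⟩ := exists_between hlt
  obtain ⟨K', hK'0, hK'⟩ := (isBigO_of_lineOrder_lt hconv hσ hm1).exists_nonneg
  obtain ⟨R', hR'0, hR'⟩ := eventually_abs_iff.mp hK'.bound
  obtain ⟨K, hK0, R, hR0, hR⟩ := exists_lower_of_symm hsymm
  obtain ⟨A, hA0, T₀, hT₀, hA⟩ := exists_mean_lower_bound hconv habs (σ := 1 - σ) (by linarith)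
  have hlim : Tendsto (fun u : ℝ => K * K' * u ^ (-(e - m))) atTop (𝓝 0) := by
    simpa using (tendsto_rpow_neg_atTop (sub_pos.mpr hm2)).const_mul (K * K')
  obtain ⟨R₂, hR₂⟩ := eventually_atTop.mp (hlim.eventually (gt_mem_nhds (half_pos hA0)))
  set T := max (max R R') (max T₀ R₂) with hT
  have hTR : R ≤ T := (le_max_left _ _).trans (le_max_left _ _)
  have hTR' : R' ≤ T := (le_max_right _ _).trans (le_max_left _ _)
  have hTT : T₀ ≤ T := (le_max_left _ _).trans (le_max_right _ _)
  have hTR₂ : R₂ ≤ T := (le_max_right _ _).trans (le_max_right _ _)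
  have hT0 : 0 < T := hT₀.trans_le hTT
  have hub : ∀ u : ℝ, T ≤ u → ‖sum c ((1 - σ : ℝ) + u * Complex.I)‖ ≤ A / 2 := by
    intro u hu
    have hu0 : 0 < u := hT0.trans_le hu
    have h1 := hR u (hTR.trans hu)
    have h2 := hR' (-u) (by rw [abs_neg, abs_of_pos hu0]; exact hTR'.trans hu)
    rw [Real.norm_of_nonneg (by positivity), abs_neg, abs_of_pos hu0] at h2
    have h3 := (hR₂ u (hTR₂.trans hu)).le
    have hue : 0 < u ^ e := by positivity
    have h4 : u ^ (-(e - m)) = u ^ m / u ^ e := by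
      rw [neg_sub, Real.rpow_sub hu0]
    rw [h4] at h3
    have h5 : u ^ e * ‖sum c ((1 - σ : ℝ) + u * Complex.I)‖ ≤ K * (K' * u ^ m) :=
      h1.trans (by gcongr)
    have h6 : ‖sum c ((1 - σ : ℝ) + u * Complex.I)‖ ≤ K * (K' * u ^ m) / u ^ e := by
      rw [le_div_iff₀ hue, mul_comm]
      exact h5
    refine h6.trans (le_trans (le_of_eq ?_) h3)
    ring
  have hint := intervalIntegral.integral_mono_on (a := T) (b := 2 * T) (by linarith)
    ((continuous_sum_line hconv (σ := 1 - σ) (by linarith)).norm.intervalIntegrable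
      (μ := volume) _ _)
    (intervalIntegrable_const (c := A / 2)) (fun u hu => hub u hu.1)
  rw [intervalIntegral.integral_const, smul_eq_mul] at hint
  nlinarith [hA T hTT]

/-! ### Convergence and divergence of the moments. -/

/-- The integrand in the definition of the moment abscissa. -/
noncomputable def momentIntegrand (c : ℕ → ℂ) (k : ℕ) (α σ t : ℝ) : ℝ :=
  ‖sum c (σ + t * Complex.I)‖ ^ (2 * k) / ‖(σ + t * Complex.I : ℂ)‖ ^ (2 * α + 1)

lemma momentIntegrand_nonneg (c : ℕ → ℂ) (k : ℕ) (α σ t : ℝ) : 0 ≤ momentIntegrand c k α σ t := by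
  unfold momentIntegrand
  positivity

lemma norm_line_pos {σ : ℝ} (hσ : 0 < σ) (t : ℝ) : 0 < ‖(σ + t * Complex.I : ℂ)‖ := by
  have := Complex.re_le_norm (σ + t * Complex.I : ℂ)
  simp only [Complex.add_re, Complex.ofReal_re, Complex.mul_re, Complex.I_re, mul_zero,
    Complex.ofReal_im, Complex.I_im, mul_one, sub_self, add_zero] at this
  linarith

lemma continuous_momentIntegrand {c : ℕ → ℂ} (hconv : abscissaOfConv c = 0) (k : ℕ) (α : ℝ) {σ : ℝ}
    (hσ : 0 < σ) : Continuous (momentIntegrand c k α σ) := by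
  refine ((continuous_sum_line hconv hσ).norm.pow _).div ?_ fun t => ?_
  · exact Continuous.rpow_const (by fun_prop) fun t => Or.inl (norm_line_pos hσ t).ne'
  · exact (Real.rpow_pos_of_pos (norm_line_pos hσ t) _).ne'

lemma lintegral_momentIntegrand_lt_top_iff {c : ℕ → ℂ} (hconv : abscissaOfConv c = 0) (k : ℕ)
    (α : ℝ) {σ : ℝ} (hσ : 0 < σ) :
    ∫⁻ t : ℝ, ENNReal.ofReal (momentIntegrand c k α σ t) < ⊤ ↔
      Integrable (momentIntegrand c k α σ) := by
  rw [lt_top_iff_ne_top]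
  exact lintegral_ofReal_ne_top_iff_integrable
    (continuous_momentIntegrand hconv k α hσ).aestronglyMeasurable
    (Eventually.of_forall fun t => momentIntegrand_nonneg c k α σ t)

lemma integrable_momentIntegrand {c : ℕ → ℂ} (hconv : abscissaOfConv c = 0) {σ e : ℝ} (hσ : 0 < σ)
    (hσ1 : σ < 1) (hsymm : (fun t : ℝ => sum c (σ + t * Complex.I)) =Θ[atBot ⊔ atTop]
      (fun t : ℝ => |t| ^ e * ‖sum c (1 - σ - t * Complex.I)‖))
    (h0 : lineOrder c (1 - σ) = 0) {k : ℕ} {α : ℝ} (hα : 0 < α) (hk : k * e < α) :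
    Integrable (momentIntegrand c k α σ) := by
  -- Small enough for k(e+ε) < α, which makes the decay exponent q below exceed 1; k+1 avoids
  -- division by zero.
  set ε := (α - k * e) / (2 * (k + 1)) with hε
  have hε0 : 0 < ε := div_pos (by linarith) (by positivity)
  have hkε : k * (e + ε) < α := by
    have h1 : ε * (2 * (k + 1)) = α - k * e := by
      rw [hε]
      field_simp
    nlinarith
  set q := -(2 * k * (e + ε) - 2 * α - 1) with hq
  have hq1 : 1 < q := by rw [hq]; linarith
  obtain ⟨K, hK0, hK⟩ := (isBigO_of_symm hconv hσ1 hsymm h0 hε0).exists_nonneg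
  have hO : momentIntegrand c k α σ =O[atBot ⊔ atTop] fun t : ℝ => (1 + ‖t‖) ^ (-q) := by
    refine IsBigO.of_bound (K ^ (2 * k) * 2 ^ q) ?_
    filter_upwards [hK.bound, eventually_le_abs 1] with t ht ht1
    have ht0 : 0 < |t| := by linarith
    rw [Real.norm_of_nonneg (by positivity)] at ht
    rw [Real.norm_of_nonneg (momentIntegrand_nonneg _ _ _ _ _),
      Real.norm_of_nonneg (by positivity), Real.norm_eq_abs, momentIntegrand]
    have h1 : |t| ≤ ‖(σ + t * Complex.I : ℂ)‖ := by
      simpa using Complex.abs_im_le_norm (σ + t * Complex.I : ℂ)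
    calc _ ≤ (K * |t| ^ (e + ε)) ^ (2 * k) / |t| ^ (2 * α + 1) := by gcongr
      _ = K ^ (2 * k) * |t| ^ (-q) := by
        rw [mul_pow, ← Real.rpow_natCast (|t| ^ (e + ε)), ← Real.rpow_mul ht0.le, mul_div_assoc,
          ← Real.rpow_sub ht0]
        congr 2
        push_cast
        rw [hq]
        ring
      _ ≤ K ^ (2 * k) * (2 ^ q * (1 + |t|) ^ (-q)) := by
        gcongr
        have h2 : (2 * |t|) ^ (-q) ≤ (1 + |t|) ^ (-q) :=
          Real.rpow_le_rpow_of_nonpos (by positivity) (by linarith) (by linarith)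
        rw [Real.mul_rpow (by norm_num) ht0.le] at h2
        have h3 : (2 : ℝ) ^ q * 2 ^ (-q) = 1 := by
          rw [← Real.rpow_add two_pos]
          simp
        have h4 : (0 : ℝ) < 2 ^ q := by positivity
        calc |t| ^ (-q) = 2 ^ q * (2 ^ (-q) * |t| ^ (-q)) := by rw [← mul_assoc, h3, one_mul]
          _ ≤ _ := by gcongr
      _ = _ := by ring
  have hint : Integrable (fun t : ℝ => (1 + ‖t‖) ^ (-q)) :=
    integrable_one_add_norm (by simpa using hq1)
  exact (continuous_momentIntegrand hconv k α hσ).locallyIntegrable.integrable_of_isBigO_atBot_atTop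
    (hO.mono le_sup_left) (hint.integrableAtFilter _) (hO.mono le_sup_right)
    (hint.integrableAtFilter _)

/-- A linear minorant of the power, replacing Hölder's inequality: it passes from the first mean of
|f| to the 2k-th. -/
lemma pow_mul_sub_le_pow {a x : ℝ} (ha : 0 ≤ a) (hx : 0 ≤ x) (n : ℕ) :
    a ^ n * (x - a) ≤ x ^ (n + 1) := by
  rcases le_total x a with h | h
  · have h1 : a ^ n * (x - a) ≤ 0 := mul_nonpos_of_nonneg_of_nonpos (by positivity) (by linarith)
    exact h1.trans (by positivity)
  · rw [pow_succ]
    have : a ^ n ≤ x ^ n := by gcongr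
    exact mul_le_mul this (by linarith) (by linarith) (by positivity)

/-- At t = -u the integrand is at least |f(1-σ+iu)|^(2k)/(κu), the endpoint ke = α included, so its
integrals over [T, 2T] do not tend to 0. -/
lemma not_integrable_momentIntegrand {c : ℕ → ℂ} (hconv : abscissaOfConv c = 0)
    (habs : LSeries.abscissaOfAbsConv c = 1) {σ e : ℝ} (hσ : 0 < σ)
    (hσ1 : σ < 1) (hsymm : (fun t : ℝ => sum c (σ + t * Complex.I)) =Θ[atBot ⊔ atTop]
      (fun t : ℝ => |t| ^ e * ‖sum c (1 - σ - t * Complex.I)‖))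
    {k : ℕ} (hk0 : k ≠ 0) {α : ℝ} (hα : 0 < α) (hk : α ≤ k * e) :
    ¬ Integrable (momentIntegrand c k α σ) := by
  intro hI
  obtain ⟨K, hK0, R, hR0, hR⟩ := exists_lower_of_symm hsymm
  obtain ⟨A, hA0, T₀, hT₀, hA⟩ := exists_mean_lower_bound hconv habs (σ := 1 - σ) (by linarith)
  obtain ⟨n, hn⟩ : ∃ n, 2 * k = n + 1 := ⟨2 * k - 1, by omega⟩
  -- K comes from reflection, the power of 2 from |σ - iu| ≤ 2u.
  set κ : ℝ := K ^ (2 * k) * 2 ^ (2 * α + 1) with hκ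
  have hκ0 : 0 < κ := by positivity
  have hcont : Continuous fun u : ℝ => ‖sum c ((1 - σ : ℝ) + u * Complex.I)‖ :=
    (continuous_sum_line hconv (σ := 1 - σ) (by linarith)).norm
  have hpt : ∀ u : ℝ, max R 1 ≤ u →
      ‖sum c ((1 - σ : ℝ) + u * Complex.I)‖ ^ (2 * k) / (κ * u) ≤
        momentIntegrand c k α σ (-u) := by
    intro u hu
    have hu1 : 1 ≤ u := (le_max_right _ _).trans hu
    have hu0 : 0 < u := by linarith
    have h1 := hR u ((le_max_left _ _).trans hu)
    have h2 : ‖(σ + (-u : ℝ) * Complex.I : ℂ)‖ ≤ 2 * u := by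
      refine (norm_add_le _ _).trans ?_
      rw [Complex.norm_real, Real.norm_of_nonneg hσ.le, norm_mul, Complex.norm_real, norm_neg,
        Real.norm_of_nonneg hu0.le, Complex.norm_I]
      linarith
    set y := ‖sum c ((1 - σ : ℝ) + u * Complex.I)‖ with hy
    have h3 : u ^ e * y / K ≤ ‖sum c (σ + (-u : ℝ) * Complex.I)‖ := by
      rw [div_le_iff₀ hK0, mul_comm _ K]
      exact h1
    have h4 : u ^ (2 * α) ≤ (u ^ e) ^ (2 * k) := by
      rw [← Real.rpow_natCast, ← Real.rpow_mul hu0.le]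
      apply Real.rpow_le_rpow_of_exponent_le hu1
      push_cast
      linarith
    have h5 : 0 < u ^ (2 * α) := by positivity
    have hpos := norm_line_pos hσ (-u)
    calc _ = u ^ (2 * α) * y ^ (2 * k) / K ^ (2 * k) / (2 * u) ^ (2 * α + 1) := by
          rw [Real.mul_rpow (by norm_num) hu0.le, Real.rpow_add hu0, Real.rpow_one, hκ]
          field_simp
      _ ≤ (u ^ e) ^ (2 * k) * y ^ (2 * k) / K ^ (2 * k) / (2 * u) ^ (2 * α + 1) := by gcongr
      _ = (u ^ e * y / K) ^ (2 * k) / (2 * u) ^ (2 * α + 1) := by rw [div_pow, mul_pow]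
      _ ≤ _ := by
        unfold momentIntegrand
        gcongr
  have hlow : ∀ T : ℝ, max (max R 1) T₀ ≤ T →
      (A / 2) ^ (2 * k) / (2 * κ) ≤ ∫ u in T..2 * T, momentIntegrand c k α σ (-u) := by
    intro T hT
    have hT1 : max R 1 ≤ T := (le_max_left _ _).trans hT
    have hT0 : 0 < T := hT₀.trans_le ((le_max_right _ _).trans hT)
    have hint := intervalIntegral.integral_mono_on (a := T) (b := 2 * T) (μ := volume)
      (f := fun u => (A / 2) ^ n / (κ * (2 * T)) *
        (‖sum c ((1 - σ : ℝ) + u * Complex.I)‖ - A / 2))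
      (g := fun u => momentIntegrand c k α σ (-u)) (by linarith)
      (Continuous.intervalIntegrable (by fun_prop) _ _)
      (((continuous_momentIntegrand hconv k α hσ).comp continuous_neg).intervalIntegrable _ _)
      (fun u hu => by
        have hu0 : 0 < u := hT0.trans_le hu.1
        refine le_trans ?_ (hpt u (hT1.trans hu.1))
        rw [hn, div_mul_eq_mul_div]
        have h1 := pow_mul_sub_le_pow (half_pos hA0).le
          (norm_nonneg (sum c ((1 - σ : ℝ) + u * Complex.I))) n
        refine (div_le_div_of_nonneg_right h1 (by positivity)).trans ?_
        have := hu.2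
        gcongr)
    refine le_trans ?_ hint
    rw [intervalIntegral.integral_const_mul, intervalIntegral.integral_sub
      (hcont.intervalIntegrable _ _) intervalIntegrable_const, intervalIntegral.integral_const,
      smul_eq_mul, hn]
    have h2 := hA T ((le_max_right _ _).trans hT)
    calc (A / 2) ^ (n + 1) / (2 * κ) = (A / 2) ^ n / (κ * (2 * T)) * (A * T - (2 * T - T) * (A / 2)) := by
          rw [pow_succ]
          field_simp
          ring
      _ ≤ _ := by gcongr
  have hI' : IntegrableOn (fun u => momentIntegrand c k α σ (-u)) (Set.Ioi 0) :=
    hI.comp_neg.integrableOn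
  -- For an integrable function the integrals over [0, T] and [0, 2T] have the same limit, so the
  -- dyadic blocks tend to 0.
  have hl1 := intervalIntegral_tendsto_integral_Ioi 0 hI' tendsto_id
  have hl2 := intervalIntegral_tendsto_integral_Ioi 0 hI'
    (tendsto_id.const_mul_atTop (two_pos : (0 : ℝ) < 2))
  have hl := hl2.sub hl1
  rw [sub_self] at hl
  have hcF : Continuous fun u => momentIntegrand c k α σ (-u) :=
    (continuous_momentIntegrand hconv k α hσ).comp continuous_neg
  have hη : 0 < (A / 2) ^ (2 * k) / (2 * κ) := by positivity
  obtain ⟨T, hT1, hT2⟩ := ((hl.eventually (gt_mem_nhds hη)).and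
    (eventually_ge_atTop (max (max R 1) T₀))).exists
  rw [intervalIntegral.integral_interval_sub_left (hcF.intervalIntegrable _ _)
    (hcF.intervalIntegrable _ _)] at hT1
  exact absurd (hlow T hT2) (not_le.mpr hT1)

/-! ### The Lindelöf abscissa and the moment abscissae. -/

lemma order_of_pos (c : ℕ → ℂ) {σ : ℝ} (hσ : 0 < σ) : order c σ = lineOrder c σ := if_pos hσ

lemma lindelofAbscissa_nonneg (c : ℕ → ℂ) : 0 ≤ lindelofAbscissa c :=
  Real.sInf_nonneg fun _ h => h.1

/-- Monotonicity carries a zero of μ to the right; μ(0) ≠ 0 ensures that this zero is at some τ > 0,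
where `lineOrder_antitone` applies. -/
lemma lineOrder_eq_zero_of_lindelofAbscissa_lt {c : ℕ → ℂ} (hconv : abscissaOfConv c = 0)
    (habs : LSeries.abscissaOfAbsConv c = 1) (h0 : order c 0 ≠ 0) {σ : ℝ}
    (hσ : lindelofAbscissa c < σ) : lineOrder c σ = 0 := by
  have h2 : order c 2 = 0 := by rw [order_of_pos c two_pos, lineOrder_two habs]
  obtain ⟨τ, ⟨hτ0, hτ⟩, hlt⟩ := exists_lt_of_csInf_lt
    (by exact ⟨2, zero_le_two, h2⟩) hσ
  have hτpos : 0 < τ := by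
    rcases hτ0.eq_or_lt with rfl | h
    · exact absurd hτ h0
    · exact h
  rw [order_of_pos c hτpos] at hτ
  exact le_antisymm ((lineOrder_antitone hconv habs hτpos hlt.le).trans_eq hτ)
    (lineOrder_nonneg _ _)

lemma lindelofAbscissa_pos {c : ℕ → ℂ} (hconv : abscissaOfConv c = 0)
    (habs : LSeries.abscissaOfAbsConv c = 1) (h0 : order c 0 ≠ 0) : 0 < lindelofAbscissa c := by
  refine (lindelofAbscissa_nonneg c).lt_of_ne fun h => h0 ?_
  have h1 : Tendsto (lineOrder c) (𝓝[>] 0) (𝓝 0) := by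
    refine tendsto_const_nhds.congr' ?_
    filter_upwards [self_mem_nhdsWithin] with σ hσ
    exact (lineOrder_eq_zero_of_lindelofAbscissa_lt hconv habs h0 (by rw [← h]; exact hσ)).symm
  rw [order, if_neg (lt_irrefl _), h1.limUnder_eq]

lemma lindelofAbscissa_eq_half {c : ℕ → ℂ} (hconv : abscissaOfConv c = 0)
    (habs : LSeries.abscissaOfAbsConv c = 1)
    (hlin : ∀ σ : ℝ, 0 ≤ σ → σ ≤ lindelofAbscissa c →
      order c σ = order c 0 * (1 - σ / lindelofAbscissa c))
    (h0 : 0 < order c 0) (hsub : order c (1 / 2) < order c 0 / 2)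
    (hsymm : ∀ σ : ℝ, 0 < σ → σ ≤ 1 / 2 →
      (fun t : ℝ => sum c (σ + t * Complex.I)) =Θ[atBot ⊔ atTop]
        (fun t : ℝ => |t| ^ (order c 0 * (1 - 2 * σ)) * ‖sum c (1 - σ - t * Complex.I)‖)) :
    lindelofAbscissa c = 1 / 2 := by
  have hL0 := lindelofAbscissa_pos hconv habs h0.ne'
  set L := lindelofAbscissa c with hL
  have hL1 : L < 1 := by
    by_contra! h
    rw [hlin (1 / 2) (by norm_num) (by linarith)] at hsub
    have h1 : 1 / 2 / L ≤ 1 / 2 := div_le_self (by norm_num) h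
    nlinarith
  -- Here σ < L gives the linear formula, while 1-σ > L gives the reflected one.
  obtain ⟨σ, hσ, hσlt⟩ : ∃ σ, 0 < σ ∧ σ < min L (min (1 - L) (1 / 2)) :=
    exists_between (lt_min hL0 (lt_min (by linarith) (by norm_num)))
  simp only [lt_min_iff] at hσlt
  have hτ : lineOrder c (1 - σ) = 0 :=
    lineOrder_eq_zero_of_lindelofAbscissa_lt hconv habs h0.ne' (by linarith)
  have h1 := lineOrder_eq_of_symm hconv habs hσ (by linarith)
    (mul_nonneg h0.le (by linarith)) (hsymm σ hσ (by linarith)) hτ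
  have h2 := hlin σ hσ.le hσlt.1.le
  rw [order_of_pos c hσ, h1] at h2
  have h3 := mul_left_cancel₀ h0.ne' h2
  have h4 : 2 * σ = σ / L := by linarith
  rw [eq_div_iff hL0.ne'] at h4
  have h5 : σ * (2 * L - 1) = 0 := by linarith
  rcases mul_eq_zero.mp h5 with h | h <;> linarith

lemma momentAbscissa_eq {c : ℕ → ℂ} (hconv : abscissaOfConv c = 0)
    (habs : LSeries.abscissaOfAbsConv c = 1) (h0 : 0 < order c 0)
    (hL : lindelofAbscissa c = 1 / 2)
    (hsymm : ∀ σ : ℝ, 0 < σ → σ ≤ 1 / 2 →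
      (fun t : ℝ => sum c (σ + t * Complex.I)) =Θ[atBot ⊔ atTop]
        (fun t : ℝ => |t| ^ (order c 0 * (1 - 2 * σ)) * ‖sum c (1 - σ - t * Complex.I)‖))
    {α : ℝ} (hα : 0 < α) {k : ℕ} (hk : α / order c 0 ≤ k) :
    momentAbscissa c k α = 1 / 2 * (1 - α / (k * order c 0)) := by
  set μ := order c 0 with hμ
  have hk0 : (0 : ℝ) < k := (div_pos hα h0).trans_le hk
  have hkn : k ≠ 0 := by
    rintro rfl
    simp at hk0
  have hkμ : 0 < k * μ := mul_pos hk0 h0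
  have hq : α / (k * μ) ≤ 1 := by
    rw [div_le_one hkμ]
    rwa [div_le_iff₀ h0] at hk
  have hq0 : 0 < α / (k * μ) := by positivity
  have hαq : α = α / (k * μ) * (k * μ) := by field_simp
  set q := α / (k * μ) with hqdef
  have hset : momentAbscissa c k α = sInf {σ : ℝ | 0 < σ ∧
      ∫⁻ t : ℝ, ENNReal.ofReal (momentIntegrand c k α σ t) < ⊤} := rfl
  -- With q = α/(kμ), the condition kμ(1-2σ) < α reads σ > (1-q)/2. Membership just to the right of
  -- that point suffices for the infimum.
  have hmem : ∀ σ : ℝ, 1 / 2 * (1 - q) < σ → σ < 1 / 2 → σ ∈ {σ : ℝ | 0 < σ ∧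
      ∫⁻ t : ℝ, ENNReal.ofReal (momentIntegrand c k α σ t) < ⊤} := by
    intro σ h1 h2
    have hσ : 0 < σ := by linarith
    refine ⟨hσ, (lintegral_momentIntegrand_lt_top_iff hconv k α hσ).mpr ?_⟩
    refine integrable_momentIntegrand hconv hσ (by linarith) (hsymm σ hσ h2.le)
      (lineOrder_eq_zero_of_lindelofAbscissa_lt hconv habs h0.ne' (by linarith)) hα ?_
    rw [hαq]
    nlinarith
  rw [hset]
  refine le_antisymm (le_of_forall_gt fun x hx => ?_) (le_csInf ?_ ?_)
  · obtain ⟨σ, h1, h2⟩ := exists_between (lt_min hx (by linarith : 1 / 2 * (1 - q) < 1 / 2))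
    rw [lt_min_iff] at h2
    exact (csInf_le ⟨0, fun _ h => h.1.le⟩ (hmem σ h1 h2.2)).trans_lt h2.1
  · obtain ⟨σ, h1, h2⟩ := exists_between (by linarith : 1 / 2 * (1 - q) < 1 / 2)
    exact ⟨σ, hmem σ h1 h2⟩
  · rintro σ ⟨hσ, hfin⟩
    by_contra! hlt
    rw [lintegral_momentIntegrand_lt_top_iff hconv k α hσ] at hfin
    refine not_integrable_momentIntegrand hconv habs hσ (by linarith)
      (hsymm σ hσ (by linarith)) hkn hα ?_ hfin
    rw [hαq]
    nlinarith

end OrdinaryDirichlet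

theorem corollary1 (c : ℕ → ℂ)
    (hconv : OrdinaryDirichlet.abscissaOfConv c = 0)
    (habs : LSeries.abscissaOfAbsConv c = 1)
    (hlin : ∀ σ : ℝ, 0 ≤ σ → σ ≤ OrdinaryDirichlet.lindelofAbscissa c →
      OrdinaryDirichlet.order c σ =
        OrdinaryDirichlet.order c 0 * (1 - σ / OrdinaryDirichlet.lindelofAbscissa c))
    (hsub : OrdinaryDirichlet.order c (1 / 2) < OrdinaryDirichlet.order c 0 / 2)
    (hsymm : ∀ σ : ℝ, 0 < σ → σ ≤ 1 / 2 →
      (fun t : ℝ => OrdinaryDirichlet.sum c (σ + t * Complex.I)) =Θ[atBot ⊔ atTop]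
        (fun t : ℝ => |t| ^ (OrdinaryDirichlet.order c 0 * (1 - 2 * σ)) *
          ‖OrdinaryDirichlet.sum c (1 - σ - t * Complex.I)‖)) :
    OrdinaryDirichlet.lindelofAbscissa c = 1 / 2 ∧
    (∀ α : ℝ, 0 < α → ∀ k : ℕ, α / OrdinaryDirichlet.order c 0 ≤ k →
      OrdinaryDirichlet.momentAbscissa c k α =
        1 / 2 * (1 - α / (k * OrdinaryDirichlet.order c 0))) ∧
    (∀ α : ℝ, 0 < α →
      Tendsto (fun k : ℕ => OrdinaryDirichlet.momentAbscissa c k α) atTop (𝓝 (1 / 2))) ∧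
    (∀ α : ℝ, 0 < α → ∀ k : ℕ, α / OrdinaryDirichlet.order c 0 ≤ k →
      OrdinaryDirichlet.momentAbscissa c (k + 2) α - OrdinaryDirichlet.momentAbscissa c (k + 1) α ≤
        OrdinaryDirichlet.momentAbscissa c (k + 1) α - OrdinaryDirichlet.momentAbscissa c k α) := by
  have h0 : 0 < OrdinaryDirichlet.order c 0 := by
    have h1 := OrdinaryDirichlet.lineOrder_nonneg c (1 / 2)
    rw [← OrdinaryDirichlet.order_of_pos c (by norm_num)] at h1
    linarith
  have hL := OrdinaryDirichlet.lindelofAbscissa_eq_half hconv habs hlin h0 hsub hsymm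
  have hmain : ∀ α : ℝ, 0 < α → ∀ k : ℕ, α / OrdinaryDirichlet.order c 0 ≤ k →
      OrdinaryDirichlet.momentAbscissa c k α =
        1 / 2 * (1 - α / (k * OrdinaryDirichlet.order c 0)) := fun α hα k hk =>
    OrdinaryDirichlet.momentAbscissa_eq hconv habs h0 hL hsymm hα hk
  refine ⟨hL, hmain, fun α hα => ?_, fun α hα k hk => ?_⟩
  · have h1 : Tendsto (fun k : ℕ => 1 / 2 * (1 - α / (k * OrdinaryDirichlet.order c 0))) atTop
        (𝓝 (1 / 2 * (1 - 0))) := by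
      refine Tendsto.const_mul _ (Tendsto.const_sub _ (Tendsto.const_div_atTop ?_ _))
      exact (tendsto_natCast_atTop_atTop (R := ℝ)).atTop_mul_const h0
    rw [sub_zero, mul_one] at h1
    refine h1.congr' ?_
    filter_upwards [(tendsto_natCast_atTop_atTop (R := ℝ)).eventually_ge_atTop
      (α / OrdinaryDirichlet.order c 0)] with k hk
    exact (hmain α hα k hk).symm
  · have hk0 : (0 : ℝ) < k := (div_pos hα h0).trans_le hk
    rw [hmain α hα k hk, hmain α hα (k + 1) (by push_cast; linarith),
      hmain α hα (k + 2) (by push_cast; linarith)]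
    generalize OrdinaryDirichlet.order c 0 = μ at h0
    push_cast
    -- The second difference of 1/k, which is positive.
    have h1 : α / (k * μ) + α / ((k + 2) * μ) - 2 * (α / ((k + 1) * μ)) =
        2 * α / (k * (k + 1) * (k + 2) * μ) := by
      field_simp
      ring
    have h2 : 0 ≤ 2 * α / (k * (k + 1) * (k + 2) * μ) := by positivity
    linarith
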